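/- **Setting.** Let $N=\{1,\dots,n\}$ be a set of varieties with $\Omega_j\in\mathbb Z_{\ge 0}$ units of variety $j$. A package is a nonempty subset of $N$; write $\mathcal P$ for the set of packages. A package multiset is a vector $\mathbf k\in\mathbb Z_{\ge0}^{\mathcal P}$; it is feasible, $\mathbf k\in\mathcal K$, if $\sum_{S\ni j}k_S\le\Omega_j$ for all $j$. A price vector $p:\mathcal P\to\mathbb R$ is extended linearly to package multisets by $p(\mathbf k)=\sum_S k_S\,p(S)$ (package-linear pricing). *Buyers.* There are buyers $l\in[L]$. Buyer $l$ consists of $\bar Q^l$ unit-demand agents with values $v^l(S,q)\in\mathbb Z_{\ge 0}$ for $S\in\mathcal P$, where $v^l(S,q)=0$ for $q>\bar Q^l$; let $\bar Q=\max_l\bar Q^l$. The value $V^l(\mathbf k)$ is the maximum of $\sum_q v^l(S_q,q)$ over all ways of giving to each agent $q\in[\bar Q^l]$ at most one package $S_q$ so that each package $S$ is used at most $k_S$ times. Buyer $l$'s demand at $p$ is $D^l(p)=\arg\max_{\mathbf k\in\mathcal K}\big(V^l(\mathbf k)-p(\mathbf k)\big)$. *Seller.* A cost function graph $G$ is a directed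 graph on $\mathcal P$ in which every arc $(T,S)$ satisfies $S\subsetneq T$, and in which there is a directed path from every package $S$ to $\{j\}$ for every $j\in S$. Let $R_0^-(S)$ be the set of packages from which $S$ can be reached (including $S$), and $R^-(S)=R_0^-(S)\setminus\{S\}$. Incremental costs are $\Delta c(S,r)\in\mathbb Z\cup\{\infty\}$, $r\ge1$, nondecreasing in $r$, with $\Delta c(\{j\},r)=\infty$ for $r>\Omega_j$, and with $\Delta c(S,r)=\infty$ for all $S$ once $r$ is large; $\bar R$ is the largest $r$ such that $\Delta c(S,r)<\infty$ for some $S$. The cost of $\mathbf k$ is $C^0(\mathbf k)=\sum_S\sum_{r=1}^{r_S}\Delta c(S,r)$ with $r_S=\sum_{T\in R_0^-(S)}k_T$, and it is assumed that $C^0(\mathbf k)\ge0$ for all $\mathbf k\in\mathcal K$. The seller's supply at $p$ is $D^0(p)=\arg\max_{\mathbf k\in\mathcal K,\,C^0(\mathbf k)<\infty}\big(p(\mathbf k)-C^0(\mathbf k)\big)$. *Equilibrium.* An allocation is a family $\pi=(\pi(l))_{l\in[L]}$ of package multisets with $\sum_l\pi(l)\in\mathcal K$; the remaining items stay with the seller.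 The pair $(p,\pi)$ is a package-linear pricing Walrasian equilibrium if $\pi$ is an allocation, $\sum_{l}\pi(l)\in D^0(p)$, and $\pi(l)\in D^l(p)$ for all $l\in[L]$. *Linear programs.* The characteristic function $\phi^G$ of $G$ is the linear map defined recursively, for $Y_S=\sum_{r\in[\bar R]}y(S,r)$, by $\phi^G_S(y)=Y_S-\sum_{T\in R^-(S)}\phi^G_T(y)$. Thus $\phi^G(y)=\Phi Y$ for a square matrix $\Phi$; put $\psi^G(p)=\Phi^{\mathsf T}p$. With $S\in\mathcal P$, $q\in[\bar Q]$, $l\in[L]$, $r\in[\bar R]$, SWLP is $$\max\ \sum_{S,q,l}v^l(S,q)x(S,q,l)-\sum_{S,r}\Delta c(S,r)y(S,r)$$ subject to $\sum_Sx(S,q,l)\le1$ for all $q,l$; $\sum_{q,l}x(S,q,l)\le\phi^G_S(y)$ for all $S$; $y(S,r)\le1$ and $x(S,q,l),y(S,r)\ge0$, where $y(S,r)=0$ if $\Delta c(S,r)=\infty$ (and $\infty\cdot 0=0$ in the objective). Its dual DSWLP is $$\min\ \sum_{q,l}b(q,l)+\sum_{S,r}d(S,r)$$ subject to $b(q,l)+p(S)\ge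 v^l(S,q)$ for all $S,q,l$; $d(S,r)-\psi^G_S(p)\ge-\Delta c(S,r)$ for all $S,r$ (void if $\Delta c(S,r)=\infty$); and $b,d,p\ge0$. **Proposition.** Let $(x,y)$ be an optimal solution of SWLP that describes an allocation, i.e. $x(S,q,l),y(S,r)\in\{0,1\}$ for all $S,q,l,r$, and let $(b,d,p)$ be any optimal solution of DSWLP. Then the prices $p$ support $(x,y)$ as a package-linear pricing Walrasian equilibrium: with $\pi(l)_S=\sum_qx(S,q,l)$, the pair $(p,\pi)$ is a package-linear pricing Walrasian equilibrium; moreover, the vector $\mathbf k=\phi^G(y)$ encoded by $y$ is a package multiset with $\mathbf k\in D^0(p)$. -/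

import Mathlib

noncomputable section

namespace PackageMarket

open scoped Classical

/-- A package: a nonempty set of the varieties `0, …, n - 1`. -/
abbrev Package (n : ℕ) : Type := {S : Finset (Fin n) // S.Nonempty}

/-- The package consisting of the single variety `j`. -/
def single {n : ℕ} (j : Fin n) : Package n := ⟨{j}, Finset.singleton_nonempty j⟩

/-- A package multiset: `k S` is the multiplicity of the package `S`. -/
abbrev PackageMultiset (n : ℕ) : Type := Package n → ℕ

/-- Unpacking: the number of units of variety `j` contained in the package multiset `k`. -/
def unpack {n : ℕ} (k : PackageMultiset n) (j : Fin n) : ℕ :=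
  ∑ S : Package n, if j ∈ S.1 then k S else 0

/-- The feasible package multisets, when there are `Ω j` units of variety `j`. -/
def feasible {n : ℕ} (Ω : Fin n → ℕ) : Set (PackageMultiset n) :=
  {k | ∀ j, unpack k j ≤ Ω j}

/-- The price of a package multiset under the package-linear pricing function given by `p`. -/
def price {n : ℕ} (p : Package n → ℝ) (k : PackageMultiset n) : ℝ :=
  ∑ S, (k S : ℝ) * p S

/-- A cost function graph: arcs `T → S` go from a package to a strict sub-package, and from every
package there is a directed path to each single variety it contains. -/
structure CostFunctionGraph (n : ℕ) where
  Arc : Package n → Package n → Prop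
  ssubset_of_arc : ∀ T S, Arc T S → S.1 ⊂ T.1
  connected_single : ∀ (S : Package n) (j : Fin n), j ∈ S.1 → Relation.ReflTransGen Arc S (single j)

namespace CostFunctionGraph

variable {n : ℕ} (G : CostFunctionGraph n)

/-- The predecessors of `S`, including `S` itself. -/
def pred₀ (S : Package n) : Finset (Package n) :=
  {T | Relation.ReflTransGen G.Arc T S}

/-- The strict predecessors of `S`. -/
def pred (S : Package n) : Finset (Package n) :=
  {T | Relation.ReflTransGen G.Arc T S ∧ T ≠ S}

theorem subset_of_path {T S : Package n} (h : Relation.ReflTransGen G.Arc T S) : S.1 ⊆ T.1 := by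
  induction h with
  | refl => exact Finset.Subset.refl _
  | tail _ h ih => exact (G.ssubset_of_arc _ _ h).1.trans ih

theorem card_lt_of_mem_pred {T S : Package n} (h : T ∈ G.pred S) : S.1.card < T.1.card := by
  simp only [pred, Finset.mem_filter, Finset.mem_univ, true_and] at h
  refine Finset.card_lt_card ((G.subset_of_path h.1).ssubset_of_ne ?_)
  exact fun e => h.2 (Subtype.ext e.symm)

/-- The number `r_S` of sold packages that are cost-connected to `S`. -/
def load (k : PackageMultiset n) (S : Package n) : ℕ := ∑ T ∈ G.pred₀ S, k T

/-- The cost of a package multiset, given incremental costs `Δc S r` (`r = 1, 2, …`), where the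
value `⊤` stands for an infinite cost. -/
def cost (Δc : Package n → ℕ → WithTop ℤ) (k : PackageMultiset n) : WithTop ℤ :=
  ∑ S : Package n, ∑ r ∈ Finset.Icc 1 (G.load k S), Δc S r

/-- The characteristic function `φ^G`, as a function of the total quantities `Y S` assigned on the
incremental cost functions: `φ_S = Y S - ∑ φ_T`, summed over the strict predecessors `T` of `S`. -/
def phi (Y : Package n → ℝ) (S : Package n) : ℝ :=
  Y S - ∑ T ∈ (G.pred S).attach, phi Y T.1
termination_by n - S.1.card
decreasing_by
  have h₁ := G.card_lt_of_mem_pred T.2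
  have h₂ := card_finset_fin_le T.1.1
  omega

/-- The matrix `Φ` of the linear map `φ^G`. -/
def phiMatrix : Matrix (Package n) (Package n) ℝ :=
  Matrix.of fun S T => G.phi (Pi.single T 1) S

/-- The characteristic function dual `ψ^G(p) = Φᵀ p`. -/
def psi (p : Package n → ℝ) : Package n → ℝ :=
  (phiMatrix G).transpose.mulVec p

end CostFunctionGraph

/-- A market with `n` varieties, one seller and `L` buyers. -/
structure Market (n L : ℕ) where
  /-- The number of units of each variety. -/
  Ω : Fin n → ℕ
  /-- The number of fictitious unit-demand agents of each buyer; they are labelled `1, …, Q l`. -/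
  Q : Fin L → ℕ
  /-- `v l S q` is the value of the package `S` for the `q`-th unit-demand agent of buyer `l`. -/
  v : Fin L → Package n → ℕ → ℕ
  v_eq_zero : ∀ l S q, Q l < q → v l S q = 0
  /-- The cost function graph of the seller. -/
  G : CostFunctionGraph n
  /-- The incremental costs `Δc S r`, for `r = 1, 2, …`. -/
  Δc : Package n → ℕ → WithTop ℤ
  Δc_single : ∀ j r, Ω j < r → Δc (single j) r = ⊤
  Δc_mono : ∀ S r, 1 ≤ r → Δc S r ≤ Δc S (r + 1)
  Δc_finite_steps : ∃ R, ∀ S r, R < r → Δc S r = ⊤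
  cost_nonneg : ∀ k ∈ feasible Ω, 0 ≤ G.cost Δc k

namespace Market

variable {n L : ℕ} (M : Market n L)

/-- The largest number of unit-demand agents of a buyer. -/
def Qbar : ℕ := Finset.univ.sup M.Q

/-- The last step at which some incremental cost is finite. -/
def Rbar : ℕ := sSup {r | ∃ S, M.Δc S r ≠ ⊤}

/-- The labels `1, …, Qbar` of unit-demand agents in the linear programs. -/
abbrev Agent : Type := Finset.Icc 1 M.Qbar

/-- The steps `1, …, Rbar` in the linear programs. -/
abbrev Step : Type := Finset.Icc 1 M.Rbar

/-- The assignments of at most one package to each unit-demand agent of buyer `l` that use each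
package `S` at most `k S` times. -/
def matchings (l : Fin L) (k : PackageMultiset n) :
    Finset (Finset.Icc 1 (M.Q l) → Option (Package n)) :=
  {s | ∀ S, (Finset.univ.filter fun q => s q = some S).card ≤ k S}

/-- The value `V^l(k)` of a package multiset for buyer `l`: the maximal value of a matching. -/
def value (l : Fin L) (k : PackageMultiset n) : ℕ :=
  (M.matchings l k).sup fun s => ∑ q, (s q).elim 0 fun S => M.v l S q

/-- The demand correspondence `D^l(p)` of buyer `l`. -/
def demand (l : Fin L) (p : Package n → ℝ) : Set (PackageMultiset n) :=
  {k | k ∈ feasible M.Ω ∧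
    ∀ k' ∈ feasible M.Ω, (M.value l k' : ℝ) - price p k' ≤ (M.value l k : ℝ) - price p k}

/-- The cost function `C^0` of the seller. -/
def sellerCost (k : PackageMultiset n) : WithTop ℤ := M.G.cost M.Δc k

/-- The utility of the seller, for package multisets of finite cost. -/
def sellerUtility (p : Package n → ℝ) (k : PackageMultiset n) : ℝ :=
  price p k - (((M.sellerCost k).untopD 0 : ℤ) : ℝ)

/-- The supply correspondence `D^0(p)` of the seller. A package multiset of infinite cost has
utility `-∞`, so the maximum runs over the feasible ones of finite cost. -/
def supply (p : Package n → ℝ) : Set (PackageMultiset n) :=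
  {k | (k ∈ feasible M.Ω ∧ M.sellerCost k ≠ ⊤) ∧
    ∀ k' ∈ feasible M.Ω, M.sellerCost k' ≠ ⊤ → M.sellerUtility p k' ≤ M.sellerUtility p k}

/-- `π` assigns package multisets to the buyers within the available supply. The remaining units
`Ω j - unpack (∑ l, π l) j` stay with the seller. -/
def IsAllocation (π : Fin L → PackageMultiset n) : Prop :=
  ∑ l, π l ∈ feasible M.Ω

/-- Package-linear pricing Walrasian equilibrium. -/
def IsWalrasianEquilibrium (p : Package n → ℝ) (π : Fin L → PackageMultiset n) : Prop :=
  M.IsAllocation π ∧ ∑ l, π l ∈ M.supply p ∧ ∀ l, π l ∈ M.demand l p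

/-- The real value of a finite incremental cost. -/
def stepCost (S : Package n) (r : ℕ) : ℝ := (((M.Δc S r).untopD 0 : ℤ) : ℝ)

/-- The value of the characteristic function at an assignment `y` of incremental cost steps. -/
def phiOf (y : Package n → M.Step → ℝ) (S : Package n) : ℝ :=
  M.G.phi (fun T => ∑ r, y T r) S

/-- Feasibility in the linear program SWLP. Steps of infinite cost cannot be used. -/
structure IsPrimalFeasible (x : Package n → M.Agent → Fin L → ℝ)
    (y : Package n → M.Step → ℝ) : Prop where
  agent_le_one : ∀ q l, ∑ S, x S q l ≤ 1
  sold_le_phi : ∀ S, ∑ q, ∑ l, x S q l - M.phiOf y S ≤ 0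
  y_le_one : ∀ S r, y S r ≤ 1
  x_nonneg : ∀ S q l, 0 ≤ x S q l
  y_nonneg : ∀ S r, 0 ≤ y S r
  y_eq_zero : ∀ (S : Package n) (r : M.Step), M.Δc S r = ⊤ → y S r = 0

/-- The objective function of SWLP. -/
def primalObjective (x : Package n → M.Agent → Fin L → ℝ) (y : Package n → M.Step → ℝ) : ℝ :=
  ∑ S, ∑ q : M.Agent, ∑ l, (M.v l S q : ℝ) * x S q l - ∑ S, ∑ r : M.Step, M.stepCost S r * y S r

/-- `(x, y)` is an optimal solution of SWLP. -/
def IsPrimalOptimal (x : Package n → M.Agent → Fin L → ℝ) (y : Package n → M.Step → ℝ) : Prop :=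
  M.IsPrimalFeasible x y ∧
    ∀ x' y', M.IsPrimalFeasible x' y' → M.primalObjective x' y' ≤ M.primalObjective x y

/-- Feasibility in the dual linear program DSWLP. The constraint of a step of infinite cost is
void. -/
structure IsDualFeasible (b : M.Agent → Fin L → ℝ) (d : Package n → M.Step → ℝ)
    (p : Package n → ℝ) : Prop where
  value_le : ∀ (S : Package n) (q : M.Agent) (l : Fin L), (M.v l S q : ℝ) ≤ b q l + p S
  neg_cost_le : ∀ (S : Package n) (r : M.Step), M.Δc S r ≠ ⊤ → -M.stepCost S r ≤ d S r - M.G.psi p S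
  b_nonneg : ∀ q l, 0 ≤ b q l
  d_nonneg : ∀ S r, 0 ≤ d S r
  p_nonneg : ∀ S, 0 ≤ p S

/-- The objective function of DSWLP. -/
def dualObjective (b : M.Agent → Fin L → ℝ) (d : Package n → M.Step → ℝ) : ℝ :=
  ∑ q, ∑ l, b q l + ∑ S, ∑ r, d S r

/-- `(b, d, p)` is an optimal solution of DSWLP. -/
def IsDualOptimal (b : M.Agent → Fin L → ℝ) (d : Package n → M.Step → ℝ)
    (p : Package n → ℝ) : Prop :=
  M.IsDualFeasible b d p ∧
    ∀ b' d' p', M.IsDualFeasible b' d' p' → M.dualObjective b d ≤ M.dualObjective b' d'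

end Market

end PackageMarket

end

/-! Strong duality makes the two optimal values equal, hence complementary slackness holds. The dual
variables are then indirect utilities: `∑ q, b q l` is the best utility of buyer `l` at `p`, and `∑
S, ∑ r, d S r` that of the seller. Dual feasibility gives the upper bounds
(`buyerUtility_le_of_isDualFeasible`, `sellerUtility_le_of_isDualFeasible`), and complementary
slackness shows that `(x, y)` attains them.

On the seller's side, `phi` inverts the passage from a package multiset to its loads (`phi_load`).
Price thus becomes a sum of `psi p S` over load units, and the seller's utility splits into
independent margins `psi p S - stepCost S r`.

The multiset `k` encoded by `y` may exceed what is sold. Surplus packages have price zero, and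
disposing of them does not raise the cost (`sellerCost_le_of_le`), so the sold multiset is optimal
for the seller as well. -/

/-! ### Farkas' lemma and linear programming duality -/

/-- **Farkas' lemma**, for finitely many linear functionals on a vector space of any dimension. -/
theorem exists_nonneg_combination_of_forall_le {ι V : Type*} [AddCommGroup V] [Module ℝ V]
    (s : Finset ι) (f : ι → V →ₗ[ℝ] ℝ) (c : V →ₗ[ℝ] ℝ)
    (h : ∀ z, (∀ i ∈ s, f i z ≤ 0) → c z ≤ 0) :
    ∃ w : ι → ℝ, (∀ i, 0 ≤ w i) ∧ c = ∑ i ∈ s, w i • f i := by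
  classical
  induction s using Finset.induction_on generalizing f c with
  | empty =>
    refine ⟨0, fun _ => le_rfl, ?_⟩
    ext z
    have h₁ := h z (by simp)
    have h₂ := h (-z) (by simp)
    rw [map_neg] at h₂
    simp only [Finset.sum_empty, LinearMap.zero_apply]
    linarith
  | insert a s ha ih =>
    by_cases hs : ∀ z, (∀ i ∈ s, f i z ≤ 0) → c z ≤ 0
    · obtain ⟨w, hw, hc⟩ := ih f c hs
      refine ⟨Function.update w a 0, fun i => ?_, ?_⟩
      · by_cases hi : i = a
        · simp [hi]
        · simp [hi, hw i]
      · rw [Finset.sum_insert ha, Function.update_self, zero_smul, zero_add, hc]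
        refine Finset.sum_congr rfl fun i hi => ?_
        rw [Function.update_of_ne (ne_of_mem_of_not_mem hi ha)]
    · push Not at hs
      obtain ⟨z, hz, hcz⟩ := hs
      have ha_pos : 0 < f a z := by
        by_contra! hle
        exact hcz.not_ge (h z (by simpa [hle] using hz))
      set t : ℝ := (f a z)⁻¹ with ht
      have ht_pos : 0 < t := inv_pos.2 ha_pos
      have hta : t * f a z = 1 := inv_mul_cancel₀ ha_pos.ne'
      -- Project along `z` onto the kernel of `f a`: composing `f i` and `c` with this projection
      -- gives the functionals below, and the constraint `a` becomes trivial.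
      have key := ih (fun i => f i - (t * f i z) • f a) (c - (t * c z) • f a) (by
        intro y hy
        have h₁ := h (y - (t * f a y) • z) (by
          intro i hi
          rcases Finset.mem_insert.1 hi with rfl | hi
          · have h₂ : f i y - t * f i y * f i z = f i y * (1 - t * f i z) := by ring
            simp [h₂, hta]
          · have h₂ := hy i hi
            simp only [LinearMap.sub_apply, LinearMap.smul_apply, smul_eq_mul] at h₂
            simp only [map_sub, map_smul, smul_eq_mul]
            linarith)
        simp only [map_sub, map_smul, smul_eq_mul] at h₁
        simp only [LinearMap.sub_apply, LinearMap.smul_apply, smul_eq_mul]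
        linarith)
      obtain ⟨w, hw, hc⟩ := key
      have hsum : ∑ i ∈ s, w i * (t * f i z) ≤ 0 :=
        Finset.sum_nonpos fun i hi => mul_nonpos_of_nonneg_of_nonpos (hw i)
          (mul_nonpos_of_nonneg_of_nonpos ht_pos.le (hz i hi))
      have hpos : 0 ≤ t * c z - ∑ i ∈ s, w i * (t * f i z) := by
        have := mul_pos ht_pos hcz
        linarith
      refine ⟨Function.update w a (t * c z - ∑ i ∈ s, w i * (t * f i z)), fun i => ?_, ?_⟩
      · by_cases hi : i = a
        · subst hi
          simpa using hpos
        · simp [hi, hw i]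
      · rw [Finset.sum_insert ha, Function.update_self]
        have hcongr : ∑ i ∈ s, Function.update w a
            (t * c z - ∑ i ∈ s, w i * (t * f i z)) i • f i = ∑ i ∈ s, w i • f i :=
          Finset.sum_congr rfl fun i hi => by
            rw [Function.update_of_ne (ne_of_mem_of_not_mem hi ha)]
        rw [hcongr]
        ext y
        have hy := LinearMap.congr_fun hc y
        simp only [LinearMap.sub_apply, LinearMap.smul_apply, smul_eq_mul, LinearMap.sum_apply,
          mul_sub, Finset.sum_sub_distrib, ← mul_assoc, ← Finset.sum_mul] at hy
        simp only [LinearMap.add_apply, LinearMap.smul_apply, smul_eq_mul, LinearMap.sum_apply,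
          ← mul_assoc]
        linarith

/-- Strong duality in linear programming: an upper bound `δ` for a linear functional `c` on a
nonempty polyhedron follows from a nonnegative combination of the constraints. -/
theorem exists_dual_certificate {ι V : Type*} [Fintype ι] [AddCommGroup V] [Module ℝ V]
    (f : ι → V →ₗ[ℝ] ℝ) (β : ι → ℝ) (c : V →ₗ[ℝ] ℝ) (δ : ℝ) (z₀ : V) (hz₀ : ∀ i, f i z₀ ≤ β i)
    (h : ∀ z, (∀ i, f i z ≤ β i) → c z ≤ δ) :
    ∃ w : ι → ℝ, (∀ i, 0 ≤ w i) ∧ (∀ z, c z = ∑ i, w i * f i z) ∧ ∑ i, w i * β i ≤ δ := by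
  -- Homogenize with an extra coordinate `t`: the constraints become `f i z ≤ β i * t`, and `none`
  -- encodes `0 ≤ t`.
  let g : Option ι → V × ℝ →ₗ[ℝ] ℝ := fun o => o.elim (-LinearMap.snd ℝ V ℝ) fun i =>
    f i ∘ₗ LinearMap.fst ℝ V ℝ - β i • LinearMap.snd ℝ V ℝ
  obtain ⟨w, hw, hc⟩ := exists_nonneg_combination_of_forall_le Finset.univ g
    (c ∘ₗ LinearMap.fst ℝ V ℝ - δ • LinearMap.snd ℝ V ℝ) (by
      rintro ⟨z, t⟩ hz
      have ht : 0 ≤ t := by simpa [g] using hz none (Finset.mem_univ _)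
      have hzi : ∀ i, f i z ≤ β i * t := fun i => by
        simpa [g] using hz (some i) (Finset.mem_univ _)
      suffices hcz : c z ≤ δ * t by simpa using hcz
      rcases ht.eq_or_lt with rfl | ht
      -- For `t = 0`, `z` is a recession direction; `a` is large enough that `c (z₀ + a • z)`
      -- exceeds `δ`.
      · by_contra! hlt
        rw [mul_zero] at hlt
        set a : ℝ := (|δ - c z₀| + 1) / c z with ha
        have ha₀ : 0 ≤ a := by positivity
        have h₁ := h (z₀ + a • z) fun i => by
          have h₂ := hzi i
          rw [mul_zero] at h₂
          rw [map_add, map_smul, smul_eq_mul]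
          linarith [hz₀ i, mul_nonpos_of_nonneg_of_nonpos ha₀ h₂]
        rw [map_add, map_smul, smul_eq_mul, ha, div_mul_cancel₀ _ hlt.ne'] at h₁
        linarith [le_abs_self (δ - c z₀)]
      · have h₁ := h (t⁻¹ • z) fun i => by
          rw [map_smul, smul_eq_mul, inv_mul_le_iff₀ ht, mul_comm]
          exact hzi i
        rwa [map_smul, smul_eq_mul, inv_mul_le_iff₀ ht, mul_comm] at h₁)
  refine ⟨fun i => w (some i), fun i => hw _, fun z => ?_, ?_⟩
  · simpa [g, Fintype.sum_option] using LinearMap.congr_fun hc (z, 0)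
  · have h₁ := LinearMap.congr_fun hc (0, 1)
    simp [g, Fintype.sum_option] at h₁
    linarith [hw none]

/-! ### The characteristic function as the inverse of the load map -/

namespace PackageMarket

open scoped Classical

namespace CostFunctionGraph

variable {n : ℕ} (G : CostFunctionGraph n)

theorem pred₀_eq_insert (S : Package n) : G.pred₀ S = insert S (G.pred S) := by
  ext T
  by_cases h : T = S
  · subst h
    simp [pred₀, pred, Relation.ReflTransGen.refl]
  · simp [pred₀, pred, h]

theorem notMem_pred (S : Package n) : S ∉ G.pred S := by simp [pred]

theorem phi_eq (Y : Package n → ℝ) (S : Package n) :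
    G.phi Y S = Y S - ∑ T ∈ G.pred S, G.phi Y T := by
  rw [phi, Finset.sum_attach (G.pred S) (G.phi Y)]

theorem sum_pred₀_phi (Y : Package n → ℝ) (S : Package n) :
    ∑ T ∈ G.pred₀ S, G.phi Y T = Y S := by
  rw [G.pred₀_eq_insert, Finset.sum_insert (G.notMem_pred S), G.phi_eq Y S]
  ring

/-- `φ^G(Y)` is the only solution of the linear system that states that the total weight of the
predecessors of every package `S` is `Y S`. -/
theorem eq_phi_of_sum_pred₀ (Y f : Package n → ℝ) (h : ∀ S, ∑ T ∈ G.pred₀ S, f T = Y S)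
    (S : Package n) : f S = G.phi Y S := by
  have hS := h S
  rw [G.pred₀_eq_insert, Finset.sum_insert (G.notMem_pred S)] at hS
  rw [G.phi_eq, ← hS, Finset.sum_congr rfl fun T hT => eq_phi_of_sum_pred₀ Y f h T]
  ring
termination_by n - S.1.card
decreasing_by
  have h₁ := G.card_lt_of_mem_pred hT
  have h₂ := card_finset_fin_le T.1
  omega

/-- The columns of `phiMatrix` solve the predecessor system for unit vectors, so their combination
solves it for `Y`; uniqueness identifies it with `phi`. -/
theorem phi_eq_sum_phiMatrix (Y : Package n → ℝ) (S : Package n) :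
    G.phi Y S = ∑ U, G.phiMatrix S U * Y U := by
  refine (G.eq_phi_of_sum_pred₀ Y (fun S => ∑ U, G.phiMatrix S U * Y U) (fun S => ?_) S).symm
  rw [Finset.sum_comm]
  simp_rw [← Finset.sum_mul, phiMatrix, Matrix.of_apply, G.sum_pred₀_phi]
  simp [Pi.single_apply]

theorem sum_mul_phi (p Y : Package n → ℝ) : ∑ S, p S * G.phi Y S = ∑ S, G.psi p S * Y S := by
  simp_rw [G.phi_eq_sum_phiMatrix, psi, Matrix.mulVec, dotProduct, Matrix.transpose_apply,
    Finset.mul_sum, Finset.sum_mul]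
  rw [Finset.sum_comm]
  exact Finset.sum_congr rfl fun _ _ => Finset.sum_congr rfl fun _ _ => by ring

theorem phi_add (Y Z : Package n → ℝ) (S : Package n) :
    G.phi (fun T => Y T + Z T) S = G.phi Y S + G.phi Z S := by
  simp_rw [G.phi_eq_sum_phiMatrix, mul_add, Finset.sum_add_distrib]

theorem phi_mul (a : ℝ) (Y : Package n → ℝ) (S : Package n) :
    G.phi (fun T => a * Y T) S = a * G.phi Y S := by
  simp_rw [G.phi_eq_sum_phiMatrix, Finset.mul_sum]
  exact Finset.sum_congr rfl fun _ _ => by ring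

theorem phi_load (k : PackageMultiset n) (S : Package n) :
    G.phi (fun T => (G.load k T : ℝ)) S = k S := by
  refine (G.eq_phi_of_sum_pred₀ _ (fun S => (k S : ℝ)) (fun S => ?_) S).symm
  simp [load]

theorem price_eq_sum_psi_mul_load (p : Package n → ℝ) (k : PackageMultiset n) :
    price p k = ∑ S, G.psi p S * (G.load k S : ℝ) := by
  rw [← G.sum_mul_phi]
  simp_rw [G.phi_load, price, mul_comm]

/-- Paths to `single j` start exactly at the packages containing `j`. Hence infinite costs beyond `Ω
j` enforce feasibility. -/
theorem load_single (k : PackageMultiset n) (j : Fin n) : G.load k (single j) = unpack k j := by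
  rw [load, unpack, ← Finset.sum_filter]
  refine Finset.sum_congr ?_ fun _ _ => rfl
  ext T
  simp only [pred₀, Finset.mem_filter, Finset.mem_univ, true_and]
  refine ⟨fun h => G.subset_of_path h (by simp [single]), fun h => G.connected_single T j h⟩

theorem load_add (k k' : PackageMultiset n) (S : Package n) :
    G.load (k + k') S = G.load k S + G.load k' S := by
  simp [load, Finset.sum_add_distrib]

end CostFunctionGraph

theorem unpack_mono {n : ℕ} {k k' : PackageMultiset n} (h : k ≤ k') (j : Fin n) :
    unpack k j ≤ unpack k' j := by
  refine Finset.sum_le_sum fun S _ => ?_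
  split_ifs
  · exact h S
  · exact le_rfl

theorem feasible_of_le {n : ℕ} {Ω : Fin n → ℕ} {k k' : PackageMultiset n} (h : k ≤ k')
    (hk' : k' ∈ feasible Ω) : k ∈ feasible Ω :=
  fun j => (unpack_mono h j).trans (hk' j)

/-! ### Costs and utility of the seller -/

namespace Market

variable {n L : ℕ} (M : Market n L)

theorem Δc_le_of_le (S : Package n) {r r' : ℕ} (hr : 1 ≤ r) (h : r ≤ r') :
    M.Δc S r ≤ M.Δc S r' := by
  induction r', h using Nat.le_induction with
  | base => exact le_rfl
  | succ m hm ih => exact ih.trans (M.Δc_mono S m (hr.trans hm))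

theorem le_Rbar {S : Package n} {r : ℕ} (h : M.Δc S r ≠ ⊤) : r ≤ M.Rbar := by
  obtain ⟨R, hR⟩ := M.Δc_finite_steps
  refine le_csSup ⟨R, ?_⟩ ⟨S, h⟩
  rintro r ⟨S, hS⟩
  by_contra! hlt
  exact hS (hR S r hlt)

theorem coe_stepCost {S : Package n} {r : ℕ} (h : M.Δc S r ≠ ⊤) :
    ∃ c : ℤ, M.Δc S r = c ∧ M.stepCost S r = c := by
  obtain ⟨c, hc⟩ := WithTop.ne_top_iff_exists.1 h
  exact ⟨c, hc.symm, by simp [stepCost, ← hc]⟩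

theorem stepCost_le_of_le {S : Package n} {r r' : ℕ} (hr : 1 ≤ r) (h : r ≤ r')
    (h' : M.Δc S r' ≠ ⊤) : M.stepCost S r ≤ M.stepCost S r' := by
  have hle := M.Δc_le_of_le S hr h
  obtain ⟨c', hc', hs'⟩ := M.coe_stepCost h'
  obtain ⟨c, hc, hs⟩ := M.coe_stepCost (ne_top_of_le_ne_top h' hle)
  rw [hc, hc', WithTop.coe_le_coe] at hle
  rw [hs, hs']
  exact_mod_cast hle

theorem sellerCost_ne_top_iff (k : PackageMultiset n) :
    M.sellerCost k ≠ ⊤ ↔ ∀ S, ∀ r ∈ Finset.Icc 1 (M.G.load k S), M.Δc S r ≠ ⊤ := by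
  simp [sellerCost, CostFunctionGraph.cost, WithTop.sum_eq_top]

theorem coe_sellerCost {k : PackageMultiset n} (h : M.sellerCost k ≠ ⊤) :
    (((M.sellerCost k).untopD 0 : ℤ) : ℝ) =
      ∑ S, ∑ r ∈ Finset.Icc 1 (M.G.load k S), M.stepCost S r := by
  have h' := (M.sellerCost_ne_top_iff k).1 h
  have hcost : M.sellerCost k =
      ((∑ S, ∑ r ∈ Finset.Icc 1 (M.G.load k S), (M.Δc S r).untopD 0 : ℤ) : WithTop ℤ) := by
    simp only [sellerCost, CostFunctionGraph.cost, WithTop.coe_sum]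
    refine Finset.sum_congr rfl fun S _ => Finset.sum_congr rfl fun r hr => ?_
    obtain ⟨c, hc, -⟩ := M.coe_stepCost (h' S r hr)
    simp [hc]
  rw [hcost, WithTop.untopD_coe]
  push_cast
  rfl

theorem sellerUtility_eq (p : Package n → ℝ) {k : PackageMultiset n} (h : M.sellerCost k ≠ ⊤) :
    M.sellerUtility p k =
      ∑ S, ∑ r ∈ Finset.Icc 1 (M.G.load k S), (M.G.psi p S - M.stepCost S r) := by
  rw [sellerUtility, M.coe_sellerCost h, M.G.price_eq_sum_psi_mul_load]
  simp [Finset.sum_sub_distrib, mul_comm]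

/-- Disposing of packages does not increase the cost of a feasible package multiset. -/
theorem sellerCost_le_of_le {k k' : PackageMultiset n} (h : k ≤ k') (hk' : k' ∈ feasible M.Ω) :
    M.sellerCost k ≤ M.sellerCost k' := by
  obtain ⟨e, rfl⟩ := exists_add_of_le h
  have he := M.cost_nonneg e (feasible_of_le (le_add_of_nonneg_left zero_le) hk')
  -- Superadditivity: stacked on top of `k`, the units of `e` occupy later steps, which are no
  -- cheaper than the first ones.
  suffices hsum : M.sellerCost k + M.sellerCost e ≤ M.sellerCost (k + e) from
    (le_add_of_nonneg_right he).trans hsum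
  simp only [sellerCost, CostFunctionGraph.cost, ← Finset.sum_add_distrib]
  refine Finset.sum_le_sum fun S _ => ?_
  rw [M.G.load_add]
  have hrange : ∀ m (f : ℕ → WithTop ℤ),
      ∑ r ∈ Finset.Icc 1 m, f r = ∑ r ∈ Finset.range m, f (r + 1) := fun m f => by
    rw [Finset.range_eq_Ico, Finset.sum_Ico_add' f 0 m 1]
    rfl
  rw [hrange, hrange, hrange, Finset.sum_range_add]
  gcongr with r
  exact M.Δc_le_of_le S (by omega) (by omega)

end Market

end PackageMarket

/-! ### Strong duality and complementary slackness for SWLP -/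

namespace PackageMarket

open scoped Classical

namespace Market

variable {n L : ℕ} (M : Market n L)

/-- The constraints of SWLP. -/
abbrev PrimalConstraint : Type :=
  (M.Agent × Fin L) ⊕ Package n ⊕ (Package n × M.Step) ⊕ (Package n × M.Agent × Fin L) ⊕
    (Package n × M.Step)

/-- The variables of SWLP. -/
abbrev PrimalVariables : Type :=
  (Package n → M.Agent → Fin L → ℝ) × (Package n → M.Step → ℝ)

theorem phiOf_add (y z : Package n → M.Step → ℝ) (S : Package n) :
    M.phiOf (y + z) S = M.phiOf y S + M.phiOf z S := by
  simp only [phiOf, Pi.add_apply, Finset.sum_add_distrib, M.G.phi_add]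

theorem phiOf_smul (a : ℝ) (y : Package n → M.Step → ℝ) (S : Package n) :
    M.phiOf (a • y) S = a * M.phiOf y S := by
  simp only [phiOf, Pi.smul_apply, smul_eq_mul, ← Finset.mul_sum, M.G.phi_mul]

/-- The left-hand sides of the constraints of SWLP. -/
noncomputable def constraintForm : M.PrimalConstraint → M.PrimalVariables →ₗ[ℝ] ℝ
  | .inl (q, l) =>
    { toFun := fun z => ∑ S, z.1 S q l
      map_add' := by simp [Finset.sum_add_distrib]
      map_smul' := by simp [Finset.mul_sum] }
  | .inr (.inl S) =>
    { toFun := fun z => ∑ q, ∑ l, z.1 S q l - M.phiOf z.2 S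
      map_add' := fun z z' => by
        simp only [Prod.fst_add, Prod.snd_add, Pi.add_apply, Finset.sum_add_distrib, phiOf_add]
        ring
      map_smul' := fun a z => by
        simp only [Prod.smul_fst, Prod.smul_snd, Pi.smul_apply, smul_eq_mul, phiOf_smul,
          ← Finset.mul_sum, RingHom.id_apply, mul_sub] }
  | .inr (.inr (.inl (S, r))) =>
    { toFun := fun z => z.2 S r
      map_add' := by simp
      map_smul' := by simp }
  | .inr (.inr (.inr (.inl (S, q, l)))) =>
    { toFun := fun z => -z.1 S q l
      map_add' := fun z z' => by simp [add_comm]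
      map_smul' := by simp }
  | .inr (.inr (.inr (.inr (S, r)))) =>
    { toFun := fun z => -z.2 S r
      map_add' := fun z z' => by simp [add_comm]
      map_smul' := by simp }

/-- The right-hand sides of the constraints of SWLP. -/
noncomputable def constraintBound : M.PrimalConstraint → ℝ
  | .inl _ => 1
  | .inr (.inl _) => 0
  -- With `0 ≤ y`, the bound 0 encodes `y S r = 0` for steps of infinite cost.
  | .inr (.inr (.inl (S, r))) => if M.Δc S r = ⊤ then 0 else 1
  | .inr (.inr (.inr _)) => 0

theorem isPrimalFeasible_iff (x : Package n → M.Agent → Fin L → ℝ) (y : Package n → M.Step → ℝ) :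
    M.IsPrimalFeasible x y ↔ ∀ i, M.constraintForm i (x, y) ≤ M.constraintBound i := by
  constructor
  · rintro h (⟨q, l⟩ | S | ⟨S, r⟩ | ⟨S, q, l⟩ | ⟨S, r⟩)
    · exact h.agent_le_one q l
    · exact h.sold_le_phi S
    · simp only [constraintForm, constraintBound, LinearMap.coe_mk, AddHom.coe_mk]
      split_ifs with hr
      · exact (h.y_eq_zero S r hr).le
      · exact h.y_le_one S r
    · exact neg_nonpos.2 (h.x_nonneg S q l)
    · exact neg_nonpos.2 (h.y_nonneg S r)
  · intro h
    have hy : ∀ S r, y S r ≤ if M.Δc S r = ⊤ then 0 else 1 :=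
      fun S r => h (.inr (.inr (.inl (S, r))))
    have hy₀ : ∀ S r, 0 ≤ y S r := fun S r =>
      neg_nonpos.1 (h (.inr (.inr (.inr (.inr (S, r))))))
    refine ⟨fun q l => h (.inl (q, l)), fun S => h (.inr (.inl S)), fun S r => ?_,
      fun S q l => neg_nonpos.1 (h (.inr (.inr (.inr (.inl (S, q, l)))))), hy₀,
      fun S r hr => le_antisymm ?_ (hy₀ S r)⟩
    · refine (hy S r).trans ?_
      split_ifs <;> norm_num
    · simpa [hr] using hy S r

/-- The objective function of SWLP as a linear functional. -/
noncomputable def primalForm : M.PrimalVariables →ₗ[ℝ] ℝ where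
  toFun z := M.primalObjective z.1 z.2
  map_add' z z' := by
    simp only [primalObjective, Prod.fst_add, Prod.snd_add, Pi.add_apply, mul_add,
      Finset.sum_add_distrib]
    ring
  map_smul' a z := by
    simp only [primalObjective, Prod.smul_fst, Prod.smul_snd, Pi.smul_apply, smul_eq_mul,
      RingHom.id_apply, mul_sub, Finset.mul_sum, mul_left_comm a]

/-- Strong duality for SWLP and DSWLP. -/
theorem exists_isDualFeasible_of_isPrimalOptimal {x : Package n → M.Agent → Fin L → ℝ}
    {y : Package n → M.Step → ℝ} (hxy : M.IsPrimalOptimal x y) :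
    ∃ b d p, M.IsDualFeasible b d p ∧ M.dualObjective b d ≤ M.primalObjective x y := by
  obtain ⟨w, hw, hc, hδ⟩ := exists_dual_certificate M.constraintForm M.constraintBound M.primalForm
    (M.primalObjective x y) (x, y) ((M.isPrimalFeasible_iff x y).1 hxy.1)
    (fun z hz => hxy.2 z.1 z.2 ((M.isPrimalFeasible_iff z.1 z.2).2 hz))
  refine ⟨fun q l => w (.inl (q, l)),
    -- Where the cost is infinite the multiplier has bound 0 and the dual constraint is void, so
    -- replacing it by 0 changes neither value nor feasibility.
    fun S r => if M.Δc S r = ⊤ then 0 else w (.inr (.inr (.inl (S, r)))),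
    fun S => w (.inr (.inl S)), ⟨fun S q l => ?_, fun S r hr => ?_, fun q l => hw _,
      fun S r => ?_, fun S => hw _⟩, ?_⟩
  -- Evaluating the certificate at a unit vector yields a dual constraint; its slack is the
  -- multiplier of the sign constraint.
  · have h := hc
      (fun S' q' l' => if S' = S then if q' = q then if l' = l then 1 else 0 else 0 else 0, 0)
    have hp : ∀ S', M.phiOf 0 S' = 0 := fun S' => by
      simpa using M.phiOf_smul 0 0 S'
    simp [primalForm, primalObjective, constraintForm, Fintype.sum_sum_type,
      Fintype.sum_prod_type, hp] at h
    linarith [hw (.inr (.inr (.inr (.inl (S, q, l)))))]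
  · have h := hc (0, fun S' r' => if S' = S then if r' = r then 1 else 0 else 0)
    have hp : ∀ S', M.phiOf (fun S' r' => if S' = S then if r' = r then 1 else 0 else 0) S' =
        M.G.phiMatrix S' S := fun S' => by
      simp [phiOf, M.G.phi_eq_sum_phiMatrix]
    simp [primalForm, primalObjective, constraintForm, Fintype.sum_sum_type,
      Fintype.sum_prod_type, hp] at h
    have hpsi : M.G.psi (fun S => w (.inr (.inl S))) S =
        ∑ T, w (.inr (.inl T)) * M.G.phiMatrix T S := by
      simp [CostFunctionGraph.psi, Matrix.mulVec, dotProduct, mul_comm]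
    rw [if_neg hr, hpsi]
    linarith [hw (.inr (.inr (.inr (.inr (S, r)))))]
  · split_ifs
    exacts [le_rfl, hw _]
  · refine le_trans (le_of_eq ?_) hδ
    simp [Fintype.sum_sum_type, constraintBound, dualObjective, Fintype.sum_prod_type]

/-- Complementary slackness for SWLP and DSWLP. -/
theorem complementary_slackness {x : Package n → M.Agent → Fin L → ℝ}
    {y : Package n → M.Step → ℝ} {b : M.Agent → Fin L → ℝ} {d : Package n → M.Step → ℝ}
    {p : Package n → ℝ} (hxy : M.IsPrimalFeasible x y) (hbdp : M.IsDualFeasible b d p)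
    (h : M.dualObjective b d ≤ M.primalObjective x y) :
    (∀ q l, b q l * (1 - ∑ S, x S q l) = 0) ∧
    (∀ S q l, x S q l * (b q l + p S - M.v l S q) = 0) ∧
    (∀ S, p S * (M.phiOf y S - ∑ q, ∑ l, x S q l) = 0) ∧
    (∀ S r, d S r * (1 - y S r) = 0) ∧
    (∀ S r, y S r * (d S r - M.G.psi p S + M.stepCost S r) = 0) := by
  have h₁ : ∀ q l, 0 ≤ b q l * (1 - ∑ S, x S q l) := fun q l =>
    mul_nonneg (hbdp.b_nonneg q l) (sub_nonneg.2 (hxy.agent_le_one q l))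
  have h₂ : ∀ S q l, 0 ≤ x S q l * (b q l + p S - M.v l S q) := fun S q l =>
    mul_nonneg (hxy.x_nonneg S q l) (sub_nonneg.2 (hbdp.value_le S q l))
  have h₃ : ∀ S, 0 ≤ p S * (M.phiOf y S - ∑ q, ∑ l, x S q l) := fun S =>
    mul_nonneg (hbdp.p_nonneg S) (by linarith [hxy.sold_le_phi S])
  have h₄ : ∀ S r, 0 ≤ d S r * (1 - y S r) := fun S r =>
    mul_nonneg (hbdp.d_nonneg S r) (sub_nonneg.2 (hxy.y_le_one S r))
  have h₅ : ∀ S r, 0 ≤ y S r * (d S r - M.G.psi p S + M.stepCost S r) := fun S r => by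
    by_cases hr : M.Δc S r = ⊤
    · simp [hxy.y_eq_zero S r hr]
    · exact mul_nonneg (hxy.y_nonneg S r) (by linarith [hbdp.neg_cost_le S r hr])
  have hphi : ∑ S, p S * M.phiOf y S = ∑ S, ∑ r, y S r * M.G.psi p S := by
    simp_rw [phiOf, M.G.sum_mul_phi, Finset.mul_sum, mul_comm]
  have hb : ∑ q, ∑ l, b q l * ∑ S, x S q l = ∑ S, ∑ q, ∑ l, x S q l * b q l := by
    simp_rw [Finset.mul_sum, mul_comm (b _ _)]
    symm
    rw [Finset.sum_comm]
    exact Finset.sum_congr rfl fun q _ => Finset.sum_comm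
  have hp : ∑ S, p S * ∑ q, ∑ l, x S q l = ∑ S, ∑ q, ∑ l, x S q l * p S := by
    simp_rw [Finset.mul_sum, mul_comm]
  have e₁ : 0 ≤ ∑ q, ∑ l, b q l * (1 - ∑ S, x S q l) :=
    Finset.sum_nonneg fun q _ => Finset.sum_nonneg fun l _ => h₁ q l
  have e₂ : 0 ≤ ∑ S, ∑ q, ∑ l, x S q l * (b q l + p S - M.v l S q) :=
    Finset.sum_nonneg fun S _ => Finset.sum_nonneg fun q _ => Finset.sum_nonneg fun l _ => h₂ S q l
  have e₃ : 0 ≤ ∑ S, p S * (M.phiOf y S - ∑ q, ∑ l, x S q l) := Finset.sum_nonneg fun S _ => h₃ S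
  have e₄ : 0 ≤ ∑ S, ∑ r, d S r * (1 - y S r) :=
    Finset.sum_nonneg fun S _ => Finset.sum_nonneg fun r _ => h₄ S r
  have e₅ : 0 ≤ ∑ S, ∑ r, y S r * (d S r - M.G.psi p S + M.stepCost S r) :=
    Finset.sum_nonneg fun S _ => Finset.sum_nonneg fun r _ => h₅ S r
  -- The five nonnegative sums add up to the dual minus the primal objective, so each vanishes.
  have total : ∑ q, ∑ l, b q l * (1 - ∑ S, x S q l) +
      ∑ S, ∑ q, ∑ l, x S q l * (b q l + p S - M.v l S q) +
      ∑ S, p S * (M.phiOf y S - ∑ q, ∑ l, x S q l) + ∑ S, ∑ r, d S r * (1 - y S r) +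
      ∑ S, ∑ r, y S r * (d S r - M.G.psi p S + M.stepCost S r) ≤ 0 := by
    refine le_trans (le_of_eq ?_) (sub_nonpos.2 h)
    simp only [dualObjective, primalObjective, mul_sub, mul_add, mul_one, Finset.sum_sub_distrib,
      Finset.sum_add_distrib, hphi, hb, hp, mul_comm (d _ _) (y _ _), mul_comm (M.stepCost _ _),
      mul_comm (M.v _ _ _ : ℝ)]
    ring
  have z₁ : ∑ q, ∑ l, b q l * (1 - ∑ S, x S q l) = 0 := by linarith
  have z₂ : ∑ S, ∑ q, ∑ l, x S q l * (b q l + p S - M.v l S q) = 0 := by linarith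
  have z₃ : ∑ S, p S * (M.phiOf y S - ∑ q, ∑ l, x S q l) = 0 := by linarith
  have z₄ : ∑ S, ∑ r, d S r * (1 - y S r) = 0 := by linarith
  have z₅ : ∑ S, ∑ r, y S r * (d S r - M.G.psi p S + M.stepCost S r) = 0 := by linarith
  have zero₁ : ∀ {α : Type} [Fintype α] (f : α → ℝ), (∀ a, 0 ≤ f a) → ∑ a, f a = 0 →
      ∀ a, f a = 0 := fun f hf hs a =>
    (Finset.sum_eq_zero_iff_of_nonneg fun a _ => hf a).1 hs a (Finset.mem_univ a)
  refine ⟨fun q l => ?_, fun S q l => ?_, fun S => zero₁ _ h₃ z₃ S, fun S r => ?_, fun S r => ?_⟩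
  · exact zero₁ _ (h₁ q) (zero₁ _ (fun q => Finset.sum_nonneg fun l _ => h₁ q l) z₁ q) l
  · exact zero₁ _ (h₂ S q) (zero₁ _ (fun q => Finset.sum_nonneg fun l _ => h₂ S q l)
      (zero₁ _ (fun S => Finset.sum_nonneg fun q _ => Finset.sum_nonneg fun l _ => h₂ S q l)
        z₂ S) q) l
  · exact zero₁ _ (h₄ S) (zero₁ _ (fun S => Finset.sum_nonneg fun r _ => h₄ S r) z₄ S) r
  · exact zero₁ _ (h₅ S) (zero₁ _ (fun S => Finset.sum_nonneg fun r _ => h₅ S r) z₅ S) r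

end Market

end PackageMarket

/-! ### Auxiliary facts on finite sums -/

/-- A finite set of positive integers has an element that is at least any given number up to its
cardinality. -/
theorem Finset.exists_mem_ge_of_le_card {A : Finset ℕ} (hA : ∀ a ∈ A, 1 ≤ a) {r : ℕ} (hr : 1 ≤ r)
    (h : r ≤ A.card) : ∃ a ∈ A, r ≤ a := by
  by_contra! hlt
  have hsub : A ⊆ Finset.Icc 1 (r - 1) := fun a ha => by
    have h₁ := hA a ha
    have h₂ := hlt a ha
    rw [Finset.mem_Icc]
    omega
  have := Finset.card_le_card hsub
  rw [Nat.card_Icc] at this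
  omega

/-- The sum of a nonincreasing sequence over `m` positive integers is at most the sum of its first
`m` terms. -/
theorem Finset.sum_le_sum_Icc_card (f : ℕ → ℝ) (A : Finset ℕ) (hA : ∀ a ∈ A, 1 ≤ a)
    (hf : ∀ a ∈ A, ∀ r, 1 ≤ r → r ≤ a → f a ≤ f r) :
    ∑ a ∈ A, f a ≤ ∑ r ∈ Finset.Icc 1 A.card, f r := by
  induction A using Finset.induction_on_max with
  | empty => simp
  | insert a s hs ih =>
    have ha : a ∉ s := fun h => (hs a h).false
    -- `a` is the largest of `s.card + 1` distinct positive integers.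
    have hcard : s.card + 1 ≤ a := by
      obtain ⟨c, hc, hle⟩ := Finset.exists_mem_ge_of_le_card hA (r := s.card + 1) (by omega)
        (by rw [Finset.card_insert_of_notMem ha])
      rcases Finset.mem_insert.1 hc with rfl | hc
      · exact hle
      · exact hle.trans (hs c hc).le
    rw [Finset.sum_insert ha, Finset.card_insert_of_notMem ha,
      Finset.sum_Icc_succ_top (by omega), add_comm]
    exact add_le_add (ih (fun c hc => hA c (Finset.mem_insert_of_mem hc))
      fun c hc => hf c (Finset.mem_insert_of_mem hc))
      (hf a (Finset.mem_insert_self a s) _ (by omega) hcard)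

theorem Fintype.sum_comp_le_of_injective {α β : Type*} [Fintype α] [Fintype β] {e : α → β}
    (he : Function.Injective e) {g : β → ℝ} (hg : ∀ b, 0 ≤ g b) : ∑ a, g (e a) ≤ ∑ b, g b := by
  have h := Finset.sum_map Finset.univ (⟨e, he⟩ : α ↪ β) g
  simp only [Function.Embedding.coeFn_mk] at h
  rw [← h]
  exact Finset.sum_le_sum_of_subset_of_nonneg (Finset.subset_univ _) fun b _ _ => hg b

/-- A sum over the selected elements, grouped by the value of the selection. -/
theorem Fintype.sum_option_elim {α β : Type*} [Fintype α] [Fintype β] [DecidableEq β]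
    (s : α → Option β) (g : β → ℝ) :
    ∑ a, (s a).elim 0 g = ∑ b, ((Finset.univ.filter fun a => s a = some b).card : ℝ) * g b := by
  have h : ∀ a, (s a).elim 0 g = ∑ b, if s a = some b then g b else 0 := fun a => by
    cases s a <;> simp
  simp_rw [h]
  rw [Finset.sum_comm]
  simp [← Finset.sum_filter]

theorem sum_eq_card_of_zero_or_one {α : Type*} [Fintype α] {f : α → ℝ}
    [DecidablePred fun a => f a = 1] (hf : ∀ a, f a = 0 ∨ f a = 1) :
    ∑ a, f a = ((Finset.univ.filter fun a => f a = 1).card : ℝ) := by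
  rw [← Finset.sum_boole]
  refine Finset.sum_congr rfl fun a _ => ?_
  rcases hf a with h | h <;> simp [h]

/-! ### Dual variables as indirect utilities -/

namespace PackageMarket

open scoped Classical

theorem CostFunctionGraph.exists_int_eq_phi {n : ℕ} (G : CostFunctionGraph n) (Y : Package n → ℤ)
    (S : Package n) : ∃ z : ℤ, (z : ℝ) = G.phi (fun T => (Y T : ℝ)) S := by
  have ih : ∀ T ∈ G.pred S, ∃ z : ℤ, (z : ℝ) = G.phi (fun T => (Y T : ℝ)) T :=
    fun T hT => exists_int_eq_phi G Y T
  choose! z hz using ih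
  refine ⟨Y S - ∑ T ∈ G.pred S, z T, ?_⟩
  rw [G.phi_eq]
  push_cast
  rw [Finset.sum_congr rfl hz]
termination_by n - S.1.card
decreasing_by
  have h₁ := G.card_lt_of_mem_pred hT
  have h₂ := card_finset_fin_le T.1
  omega

namespace Market

variable {n L : ℕ} (M : Market n L)

/-- Each load unit at a finite-cost step has margin at most `d S r`, and the unused `d S r` are
nonnegative. -/
theorem sellerUtility_le_of_isDualFeasible {b : M.Agent → Fin L → ℝ} {d : Package n → M.Step → ℝ}
    {p : Package n → ℝ} (h : M.IsDualFeasible b d p) {k : PackageMultiset n}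
    (hk : M.sellerCost k ≠ ⊤) : M.sellerUtility p k ≤ ∑ S, ∑ r, d S r := by
  rw [M.sellerUtility_eq p hk]
  refine Finset.sum_le_sum fun S _ => ?_
  have hfin := (M.sellerCost_ne_top_iff k).1 hk S
  let e : Finset.Icc 1 (M.G.load k S) → M.Step := fun r =>
    ⟨r, Finset.mem_Icc.2 ⟨(Finset.mem_Icc.1 r.2).1, M.le_Rbar (hfin r r.2)⟩⟩
  have he : Function.Injective e := fun r r' hr => Subtype.ext (congrArg (fun t => t.1) hr)
  rw [← Finset.sum_coe_sort]
  refine le_trans (Finset.sum_le_sum fun r _ => ?_)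
    (Fintype.sum_comp_le_of_injective he (h.d_nonneg S))
  have := h.neg_cost_le S (e r) (hfin r r.2)
  change _ ≤ d S (e r)
  change -M.stepCost S r ≤ _ at this
  linarith

/-- Slackness makes `d` the margin on steps selected by `y` and zero elsewhere. The selected steps
may have gaps, whereas the cost charges the first ones; since margins are nonincreasing in `r`,
closing the gaps can only help. -/
theorem le_sellerUtility_of_complementary_slackness {y : Package n → M.Step → ℝ}
    {d : Package n → M.Step → ℝ} {p : Package n → ℝ} {k : PackageMultiset n}
    (hy : ∀ S r, y S r = 0 ∨ y S r = 1)
    (hy_top : ∀ (S : Package n) (r : M.Step), M.Δc S r = ⊤ → y S r = 0)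
    (hk : ∀ S, (k S : ℝ) = M.phiOf y S)
    (hd : ∀ S r, d S r * (1 - y S r) = 0)
    (hs : ∀ S r, y S r * (d S r - M.G.psi p S + M.stepCost S r) = 0) :
    M.sellerCost k ≠ ⊤ ∧ ∑ S, ∑ r, d S r ≤ M.sellerUtility p k := by
  let A : Package n → Finset ℕ := fun S =>
    (Finset.univ.filter fun r => y S r = 1).map (Function.Embedding.subtype _)
  have hA : ∀ S a, a ∈ A S → ∃ h, y S ⟨a, h⟩ = 1 := fun S a ha => by
    obtain ⟨r, hr, rfl⟩ := Finset.mem_map.1 ha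
    exact ⟨r.2, (Finset.mem_filter.1 hr).2⟩
  have hA_pos : ∀ S, ∀ a ∈ A S, 1 ≤ a := fun S a ha => (Finset.mem_Icc.1 (hA S a ha).1).1
  have hA_fin : ∀ S, ∀ a ∈ A S, M.Δc S a ≠ ⊤ := fun S a ha htop => by
    obtain ⟨h, h₁⟩ := hA S a ha
    rw [hy_top S ⟨a, h⟩ htop] at h₁
    exact zero_ne_one h₁
  have hload : ∀ S, M.G.load k S = (A S).card := fun S => by
    have h : (M.G.load k S : ℝ) = ∑ r, y S r := by
      rw [CostFunctionGraph.load, Nat.cast_sum, Finset.sum_congr rfl fun T _ => hk T]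
      exact M.G.sum_pred₀_phi _ S
    rw [sum_eq_card_of_zero_or_one (hy S)] at h
    rw [Finset.card_map]
    exact_mod_cast h
  have hcost : M.sellerCost k ≠ ⊤ := by
    rw [M.sellerCost_ne_top_iff]
    intro S r hr
    rw [hload, Finset.mem_Icc] at hr
    obtain ⟨a, ha, hle⟩ := Finset.exists_mem_ge_of_le_card (hA_pos S) hr.1 hr.2
    exact ne_top_of_le_ne_top (hA_fin S a ha) (M.Δc_le_of_le S hr.1 hle)
  refine ⟨hcost, ?_⟩
  rw [M.sellerUtility_eq p hcost]
  refine Finset.sum_le_sum fun S _ => ?_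
  rw [hload]
  refine le_trans (le_of_eq ?_) (Finset.sum_le_sum_Icc_card _ (A S) (hA_pos S) fun a ha r hr hra =>
    sub_le_sub_left (M.stepCost_le_of_le hr hra (hA_fin S a ha)) _)
  rw [Finset.sum_map, Finset.sum_filter]
  refine Finset.sum_congr rfl fun r _ => ?_
  have h₁ := hd S r
  have h₂ := hs S r
  rcases hy S r with h | h
  · rw [if_neg (by simp [h])]
    simpa [h] using h₁
  · rw [if_pos h]
    rw [h, one_mul] at h₂
    simp only [Function.Embedding.subtype_apply]
    linarith

/-- The agents of buyer `l` among the agents of the linear programs. -/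
def agentOf (l : Fin L) (q : Finset.Icc 1 (M.Q l)) : M.Agent :=
  ⟨q, Finset.mem_Icc.2 ⟨(Finset.mem_Icc.1 q.2).1,
    (Finset.mem_Icc.1 q.2).2.trans (Finset.le_sup (f := M.Q) (Finset.mem_univ l))⟩⟩

theorem agentOf_injective (l : Fin L) : Function.Injective (M.agentOf l) :=
  fun _ _ h => Subtype.ext (congrArg (fun t => t.1) h)

/-- In a best matching each agent gains at most `b q l` net of price; packages of `k` left unmatched
cost a nonnegative amount. -/
theorem buyerUtility_le_of_isDualFeasible {b : M.Agent → Fin L → ℝ} {d : Package n → M.Step → ℝ}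
    {p : Package n → ℝ} (h : M.IsDualFeasible b d p) (l : Fin L) (k : PackageMultiset n) :
    (M.value l k : ℝ) - price p k ≤ ∑ q, b q l := by
  have hne : (M.matchings l k).Nonempty := ⟨fun _ => none, by simp [matchings]⟩
  obtain ⟨s, hs, hval⟩ := Finset.exists_mem_eq_sup _ hne
    fun s => ∑ q, (s q).elim 0 fun S => M.v l S q
  have hs' := (Finset.mem_filter.1 hs).2
  have h₁ : (M.value l k : ℝ) ≤ ∑ q, b (M.agentOf l q) l + ∑ q, (s q).elim 0 p := by
    rw [value, hval, ← Finset.sum_add_distrib]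
    push_cast
    refine Finset.sum_le_sum fun q _ => ?_
    cases s q with
    | none => simpa using h.b_nonneg (M.agentOf l q) l
    | some S => exact h.value_le S (M.agentOf l q) l
  have h₂ : ∑ q, (s q).elim 0 p ≤ price p k := by
    rw [Fintype.sum_option_elim, price]
    exact Finset.sum_le_sum fun S _ =>
      mul_le_mul_of_nonneg_right (Nat.cast_le.2 (hs' S)) (h.p_nonneg S)
  have h₃ := Fintype.sum_comp_le_of_injective (M.agentOf_injective l) (h.b_nonneg · l)
  linarith

/-- The 0-1 solution `x` is itself a matching, and slackness turns each `b q l` into the agent's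
value minus price. -/
theorem le_buyerUtility_of_complementary_slackness {x : Package n → M.Agent → Fin L → ℝ}
    {b : M.Agent → Fin L → ℝ} {p : Package n → ℝ} {l : Fin L} {k : PackageMultiset n}
    (hx : ∀ S q l, x S q l = 0 ∨ x S q l = 1) (hle : ∀ q l, ∑ S, x S q l ≤ 1)
    (hk : ∀ S, (k S : ℝ) = ∑ q, x S q l)
    (hb : ∀ q l, b q l * (1 - ∑ S, x S q l) = 0)
    (hs : ∀ S q l, x S q l * (b q l + p S - M.v l S q) = 0) :
    ∑ q, b q l ≤ (M.value l k : ℝ) - price p k := by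
  have hx₀ : ∀ S q l, 0 ≤ x S q l := fun S q l => by
    rcases hx S q l with h | h <;> simp [h]
  have huniq : ∀ q S S', x S q l = 1 → x S' q l = 1 → S = S' := fun q S S' h h' => by
    by_contra hne
    have := Finset.add_le_sum (fun T _ => hx₀ T q l) (Finset.mem_univ S) (Finset.mem_univ S') hne
    linarith [hle q l]
  let s : Finset.Icc 1 (M.Q l) → Option (Package n) := fun q =>
    if h : ∃ S, x S (M.agentOf l q) l = 1 then some h.choose else none
  have hsome : ∀ q S, s q = some S ↔ x S (M.agentOf l q) l = 1 := fun q S => by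
    by_cases h : ∃ S, x S (M.agentOf l q) l = 1
    · simp only [s, dif_pos h, Option.some.injEq]
      exact ⟨fun e => e ▸ h.choose_spec, fun e => huniq _ _ _ h.choose_spec e⟩
    · simp only [s, dif_neg h]
      simpa using fun e => h ⟨S, e⟩
  have hmem : s ∈ M.matchings l k := by
    refine Finset.mem_filter.2 ⟨Finset.mem_univ _, fun S => ?_⟩
    have hcard : (k S : ℝ) = ((Finset.univ.filter fun q => x S q l = 1).card : ℝ) := by
      rw [hk, sum_eq_card_of_zero_or_one fun q => hx S q l]
    rw [Nat.cast_inj] at hcard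
    rw [hcard]
    refine Finset.card_le_card_of_injOn (M.agentOf l) (fun q hq => ?_)
      (M.agentOf_injective l).injOn
    simpa [hsome] using hq
  have hval : ∑ q : M.Agent, ∑ S, (M.v l S q : ℝ) * x S q l ≤ M.value l k := by
    have h₁ : ∑ q, ((s q).elim 0 fun S => M.v l S q) ≤ M.value l k :=
      Finset.le_sup (f := fun s : Finset.Icc 1 (M.Q l) → Option (Package n) =>
        ∑ q, (s q).elim 0 fun S => M.v l S q) hmem
    refine le_trans (le_of_eq ?_) (Nat.cast_le (α := ℝ).2 h₁)
    push_cast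
    symm
    refine Fintype.sum_of_injective (M.agentOf l) (M.agentOf_injective l) _ _ (fun q hq => ?_)
      fun q => ?_
    -- Agents beyond `Q l` may hold packages in `x`, but value them at zero.
    · refine Finset.sum_eq_zero fun S _ => ?_
      rw [M.v_eq_zero l S q, Nat.cast_zero, zero_mul]
      by_contra! hqQ
      exact hq ⟨⟨q, Finset.mem_Icc.2 ⟨(Finset.mem_Icc.1 q.2).1, hqQ⟩⟩, rfl⟩
    · cases hq : s q with
      | none =>
        symm
        simp only [Option.elim_none, Nat.cast_zero]
        refine Finset.sum_eq_zero fun S _ => ?_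
        have hS : ¬ x S (M.agentOf l q) l = 1 := by simp [← hsome, hq]
        rw [(hx S _ l).resolve_right hS, mul_zero]
      | some S =>
        rw [hsome] at hq
        rw [Finset.sum_eq_single S]
        · rw [hq, mul_one]
          rfl
        · intro S' _ hne
          rw [(hx S' _ l).resolve_right fun h => hne (huniq _ _ _ h hq), mul_zero]
        · simp
  have hprice : price p k = ∑ q : M.Agent, ∑ S, p S * x S q l := by
    rw [price, Finset.sum_comm]
    exact Finset.sum_congr rfl fun S _ => by rw [hk, Finset.sum_mul]; simp [mul_comm]
  have hb' : ∑ q, b q l = ∑ q : M.Agent, ∑ S, ((M.v l S q : ℝ) * x S q l - p S * x S q l) := by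
    refine Finset.sum_congr rfl fun q _ => ?_
    have h₁ : b q l = ∑ S, b q l * x S q l := by
      rw [← Finset.mul_sum]
      linarith [hb q l]
    rw [h₁]
    exact Finset.sum_congr rfl fun S _ => by linarith [hs S q l]
  simp only [Finset.sum_sub_distrib] at hb'
  linarith

end Market

end PackageMarket

/-! ### The equilibrium -/

theorem mainTheorem4 {n L : ℕ} (M : PackageMarket.Market n L)
    (x : PackageMarket.Package n → M.Agent → Fin L → ℝ)
    (y : PackageMarket.Package n → M.Step → ℝ)
    (hxy : M.IsPrimalOptimal x y)
    (hx : ∀ S q l, x S q l = 0 ∨ x S q l = 1)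
    (hy : ∀ S r, y S r = 0 ∨ y S r = 1)
    (b : M.Agent → Fin L → ℝ) (d : PackageMarket.Package n → M.Step → ℝ)
    (p : PackageMarket.Package n → ℝ)
    (hbdp : M.IsDualOptimal b d p) :
    ∃ (π : Fin L → PackageMarket.PackageMultiset n) (k : PackageMarket.PackageMultiset n),
      (∀ l S, (π l S : ℝ) = ∑ q, x S q l) ∧
      (∀ S, (k S : ℝ) = M.phiOf y S) ∧
      M.IsWalrasianEquilibrium p π ∧
      k ∈ M.supply p := by
  classical
  obtain ⟨b', d', p', hfeas', hle'⟩ := M.exists_isDualFeasible_of_isPrimalOptimal hxy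
  obtain ⟨hxy, -⟩ := hxy
  obtain ⟨hfeas, hmin⟩ := hbdp
  obtain ⟨cs₁, cs₂, cs₃, cs₄, cs₅⟩ :=
    M.complementary_slackness hxy hfeas ((hmin b' d' p' hfeas').trans hle')
  let π : Fin L → PackageMarket.PackageMultiset n := fun l S =>
    (Finset.univ.filter fun q => x S q l = 1).card
  have hπ : ∀ l S, (π l S : ℝ) = ∑ q, x S q l := fun l S =>
    (sum_eq_card_of_zero_or_one fun q => hx S q l).symm
  have hk_exists : ∀ S, ∃ m : ℕ, (m : ℝ) = M.phiOf y S := fun S => by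
    obtain ⟨z, hz⟩ := M.G.exists_int_eq_phi
      (fun T => ((Finset.univ.filter fun r => y T r = 1).card : ℤ)) S
    have hphi : (z : ℝ) = M.phiOf y S := by
      rw [hz, PackageMarket.Market.phiOf]
      congr 1
      funext T
      rw [sum_eq_card_of_zero_or_one (hy T), Int.cast_natCast]
    -- The integer `z` dominates the quantity sold of `S`.
    have hz₀ : 0 ≤ z := by
      have h₁ : 0 ≤ ∑ q, ∑ l, x S q l :=
        Finset.sum_nonneg fun q _ => Finset.sum_nonneg fun l _ => hxy.x_nonneg S q l
      have h₂ := hxy.sold_le_phi S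
      rw [← hphi] at h₂
      exact_mod_cast (by linarith : (0 : ℝ) ≤ z)
    lift z to ℕ using hz₀
    exact ⟨z, by simpa using hphi⟩
  choose k hk using hk_exists
  obtain ⟨hcost, hutil⟩ :=
    M.le_sellerUtility_of_complementary_slackness hy hxy.y_eq_zero hk cs₄ cs₅
  have hk_feas : k ∈ PackageMarket.feasible M.Ω := fun j => by
    rw [← M.G.load_single]
    by_contra! hlt
    exact (M.sellerCost_ne_top_iff k).1 hcost (PackageMarket.single j)
      (M.G.load k (PackageMarket.single j)) (Finset.mem_Icc.2 ⟨by omega, le_rfl⟩)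
      (M.Δc_single j _ hlt)
  have hsum : ∀ S, ((∑ l, π l) S : ℝ) = ∑ q, ∑ l, x S q l := fun S => by
    rw [Finset.sum_apply, Nat.cast_sum, Finset.sum_comm]
    exact Finset.sum_congr rfl fun l _ => hπ l S
  have hπk : ∑ l, π l ≤ k := fun S => by
    have h := hxy.sold_le_phi S
    rw [← hsum, ← hk] at h
    exact_mod_cast sub_nonpos.1 h
  have hπl : ∀ l, π l ≤ ∑ l, π l := fun l =>
    Finset.single_le_sum (fun _ _ => zero_le) (Finset.mem_univ l)
  have hπ_feas := PackageMarket.feasible_of_le hπk hk_feas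
  have hπ_cost_le := M.sellerCost_le_of_le hπk hk_feas
  have hπ_cost := ne_top_of_le_ne_top hcost hπ_cost_le
  -- By slackness, a package with unsold copies has price zero.
  have hprice : PackageMarket.price p (∑ l, π l) = PackageMarket.price p k := by
    refine Finset.sum_congr rfl fun S _ => ?_
    have h := cs₃ S
    rw [← hsum, ← hk] at h
    linarith
  have hπ_util : M.sellerUtility p k ≤ M.sellerUtility p (∑ l, π l) := by
    rw [PackageMarket.Market.sellerUtility, PackageMarket.Market.sellerUtility, hprice]
    refine sub_le_sub_left ?_ _
    obtain ⟨c, hc⟩ := WithTop.ne_top_iff_exists.1 hcost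
    obtain ⟨c', hc'⟩ := WithTop.ne_top_iff_exists.1 hπ_cost
    rw [← hc, ← hc', WithTop.coe_le_coe] at hπ_cost_le
    rw [← hc, ← hc', WithTop.untopD_coe, WithTop.untopD_coe]
    exact_mod_cast hπ_cost_le
  refine ⟨π, k, hπ, hk, ⟨hπ_feas, ⟨⟨hπ_feas, hπ_cost⟩, fun k' _ hk' => ?_⟩, fun l =>
    ⟨PackageMarket.feasible_of_le (hπl l) hπ_feas, fun k' _ => ?_⟩⟩,
    ⟨⟨hk_feas, hcost⟩, fun k' _ hk' => ?_⟩⟩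
  · exact (M.sellerUtility_le_of_isDualFeasible hfeas hk').trans (hutil.trans hπ_util)
  · exact (M.buyerUtility_le_of_isDualFeasible hfeas l k').trans
      (M.le_buyerUtility_of_complementary_slackness hx hxy.agent_le_one (hπ l) cs₁ cs₂)
  · exact (M.sellerUtility_le_of_isDualFeasible hfeas hk').trans hutil
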